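/- Let $n,M\ge 1$ be integers and $t_0\ge 0$. A signed digraph $\mathcal G=(\mathcal V,\mathcal E,\mathcal A)$ on the nodes $v_1,\dots,v_n$ is given by a real $n\times n$ adjacency matrix $\mathcal A=[a_{ij}]$ with $a_{ii}=0$, where $(v_j,v_i)\in\mathcal E$ if and only if $a_{ij}\ne 0$; its Laplacian is $L=[l_{ij}]$ with $l_{ii}=\sum_{k}|a_{ik}|$ and $l_{ij}=-a_{ij}$ for $j\ne i$. Let $\mathcal G_{\sigma_1},\dots,\mathcal G_{\sigma_M}$ be signed digraphs on these nodes, and let $\mathcal G(t)$, $t\ge t_0$, with adjacency matrix $\mathcal A(t)$ and Laplacian $L(t)$, switch among them with a dwell time: there are $\tau>0$ and times $t_0<t_1<t_2<\cdots$ with $t_{k+1}-t_k\ge\tau$ for all $k\ge 0$ such that, for each $k$, $\mathcal G(t)$ is constant on $[t_k,t_{k+1})$ and equal there to one of the $\mathcal G_{\sigma_p}$. Suppose that (i) there is a constant $T>0$ such that for every $p\in\{1,\dots,M\}$ and every $\hat t\ge t_0$ there is $t\in[\hat t,\hat t+T]$ with $\mathcal G(t)=\mathcal G_{\sigma_p}$;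 (ii) the union of $\mathcal G_{\sigma_1},\dots,\mathcal G_{\sigma_M}$ (the digraph on $v_1,\dots,v_n$ whose edge set is the union of their edge sets) is strongly connected, that is, it has a directed path from any node to any other node; (iii) $\mathcal G(t)$ is simultaneously structurally unbalanced, that is, there is no constant diagonal matrix $D$ with diagonal entries in $\{1,-1\}$ such that $D\mathcal A(t)D=|\mathcal A(t)|$ (the entrywise absolute value) for all $t\ge t_0$. Let $\Phi(t,t_0)$, $t\ge t_0$, be the state transition matrix of $\dot x(t)=-L(t)x(t)$, i.e. the unique continuous matrix function with $\Phi(t_0,t_0)=I$ and $\frac{d}{dt}\Phi(t,t_0)=-L(t)\Phi(t,t_0)$ for $t\ge t_0$ (derivative from the right at the switching times). Then $\lim_{t\to\infty}\Phi(t,t_0)=0$, and the limit is approached exponentially fast: there are constants $C>0$ and $\lambda>0$ such that $\|\Phi(t,t_0)\|_\infty\le C e^{-\lambda(t-t_0)}$ for all $t\ge t_0$. -/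

import Mathlib

open scoped Matrix.Norms.Operator

namespace SignedNet

/-- A signed digraph on the nodes `0, …, n - 1`, given by its weighted adjacency matrix
`adj = [a_ij]`, with no self-loops. The weight `a_ij` belongs to the edge from `j` to `i`. -/
@[ext]
structure SignedDigraph (n : ℕ) where
  adj : Matrix (Fin n) (Fin n) ℝ
  adj_self : ∀ i, adj i i = 0

/-- The edge set: `(j, i)` (an edge from `j` to `i`) is an edge iff `a_ij ≠ 0`. -/
def SignedDigraph.edges {n : ℕ} (G : SignedDigraph n) : Set (Fin n × Fin n) :=
  {e | G.adj e.2 e.1 ≠ 0}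

open Classical in
/-- The neighbours of node `i`: the nodes `j` with an edge from `j` to `i`. -/
noncomputable def SignedDigraph.neighbors {n : ℕ} (G : SignedDigraph n) (i : Fin n) :
    Finset (Fin n) :=
  Finset.univ.filter fun j => (j, i) ∈ G.edges

/-- The Laplacian matrix of a signed digraph. -/
noncomputable def SignedDigraph.laplacian {n : ℕ} (G : SignedDigraph n) :
    Matrix (Fin n) (Fin n) ℝ :=
  Matrix.of fun i j => if j = i then ∑ k ∈ G.neighbors i, |G.adj i k| else -G.adj i j

/-- The edge set of the union of a family of signed digraphs (on the common node set). -/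
def unionEdges {n : ℕ} {ι : Type*} (F : ι → SignedDigraph n) : Set (Fin n × Fin n) :=
  ⋃ p, (F p).edges

/-- A directed path from `i` to `j`: a finite sequence of distinct nodes `v 0, …, v l`, starting
at `i`, ending at `j`, and joined by consecutive edges. -/
def HasPath {n : ℕ} (E : Set (Fin n × Fin n)) (i j : Fin n) : Prop :=
  ∃ (l : ℕ) (v : Fin (l + 1) → Fin n), Function.Injective v ∧ v 0 = i ∧ v (Fin.last l) = j ∧
    ∀ k : Fin l, (v k.castSucc, v k.succ) ∈ E

/-- The digraph with edge set `E` has paths between each ordered pair of distinct nodes. -/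
def StronglyConnected {n : ℕ} (E : Set (Fin n × Fin n)) : Prop :=
  ∀ i j : Fin n, i ≠ j → HasPath E i j

/-- `G(t)`, `t ≥ t₀`, switches among the finitely many signed digraphs `Gσ p`: there are switching
instants `t₀ = s 0 < s 1 < ⋯`, with a positive lower bound (dwell time) on their increments, such
that on each `[s k, s (k+1))` the signal `G` is constantly equal to one of the `Gσ p`. -/
def IsSwitching {n M : ℕ} (Gσ : Fin M → SignedDigraph n) (t₀ : ℝ) (G : ℝ → SignedDigraph n) :
    Prop :=
  ∃ (s : ℕ → ℝ) (τ : ℝ) (Gk : ℕ → SignedDigraph n), s 0 = t₀ ∧ 0 < τ ∧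
    (∀ k, τ ≤ s (k + 1) - s k) ∧ (∀ k, Gk k ∈ Set.range Gσ) ∧
    ∀ k, ∀ t ∈ Set.Ico (s k) (s (k + 1)), G t = Gk k

/-- For some constant `T > 0`, each `Gσ p` is visited during every time window
`[t̂, t̂ + T]` with `t̂ ≥ t₀`. -/
def Recurrent {n M : ℕ} (Gσ : Fin M → SignedDigraph n) (t₀ : ℝ) (G : ℝ → SignedDigraph n) :
    Prop :=
  ∃ T > 0, ∀ p : Fin M, ∀ u ≥ t₀, ({t | G t = Gσ p} ∩ Set.Icc u (u + T)).Nonempty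

/-- Simultaneous structural balance on `[t₀, ∞)`: one constant diagonal `±1` matrix `D`
satisfies `D A(t) D = |A(t)|` for all `t ≥ t₀`. -/
def SimultaneouslyBalanced {n : ℕ} (t₀ : ℝ) (G : ℝ → SignedDigraph n) : Prop :=
  ∃ d : Fin n → ℝ, (∀ i, d i = 1 ∨ d i = -1) ∧
    ∀ t ≥ t₀, Matrix.diagonal d * (G t).adj * Matrix.diagonal d = (G t).adj.map (fun a => |a|)

/-- Simultaneous structural unbalance: the negation of simultaneous structural balance. -/
def SimultaneouslyUnbalanced {n : ℕ} (t₀ : ℝ) (G : ℝ → SignedDigraph n) : Prop :=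
  ¬ SimultaneouslyBalanced t₀ G

/-- `Φ = Φ(·, t₀)` is the state transition matrix on `[t₀, ∞)` of the linear system `ξ' = B(t) ξ`
with right-continuous piecewise constant coefficient `B`: it is continuous, it starts at the
identity, and `Φ'(t) = B(t) Φ(t)` for `t ≥ t₀`, where the derivative is from the right
because a two-sided one need not exist at the switching instants. For the systems considered here
such a `Φ` exists and is unique on `[t₀, ∞)`; see the two theorems at the end. -/
structure IsStateTransition {n : ℕ} (B : ℝ → Matrix (Fin n) (Fin n) ℝ) (t₀ : ℝ)
    (Φ : ℝ → Matrix (Fin n) (Fin n) ℝ) : Prop where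
  continuousOn : ContinuousOn Φ (Set.Ici t₀)
  initial : Φ t₀ = 1
  deriv_right : ∀ t ≥ t₀, HasDerivWithinAt Φ (B t * Φ t) (Set.Ici t) t

/-- The dwell time makes the switching intervals cover `[s 0, ∞)`. -/
theorem exists_mem_Ico_of_dwell {s : ℕ → ℝ} {τ : ℝ} (hτ : 0 < τ)
    (hs : ∀ k, τ ≤ s (k + 1) - s k) {t : ℝ} (ht : s 0 ≤ t) :
    ∃ k, t ∈ Set.Ico (s k) (s (k + 1)) := by
  have hlow : ∀ k : ℕ, s 0 + k * τ ≤ s k := by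
    intro k
    induction k with
    | zero => simp
    | succ k ih => have := hs k; push_cast; linarith
  have hex : ∃ m : ℕ, t < s m := by
    obtain ⟨m, hm⟩ := exists_nat_gt ((t - s 0) / τ)
    refine ⟨m, ?_⟩
    rw [div_lt_iff₀ hτ] at hm
    linarith [hlow m]
  classical
  obtain ⟨k, hk⟩ : ∃ k, Nat.find hex = k + 1 := by
    refine Nat.exists_eq_succ_of_ne_zero fun h0 => ?_
    have := Nat.find_spec hex
    rw [h0] at this
    linarith
  refine ⟨k, ?_, ?_⟩
  · have := Nat.find_min hex (m := k) (by omega)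
    linarith
  · have := Nat.find_spec hex
    rwa [hk] at this

/-- Existence of the state transition matrix of `x' = -L(t) x`. -/
theorem exists_isStateTransition {n M : ℕ} {Gσ : Fin M → SignedDigraph n} {t₀ : ℝ}
    {G : ℝ → SignedDigraph n} (h : IsSwitching Gσ t₀ G) :
    ∃ Φ, IsStateTransition (fun t => -(G t).laplacian) t₀ Φ := by
  obtain ⟨s, τ, Gk, h0, hτ, hs, -, hG⟩ := h
  have hstep : ∀ k, s k < s (k + 1) := fun k => by linarith [hs k]
  have hmono : StrictMono s := strictMono_nat_of_lt_succ hstep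
  let E : ℕ → ℝ → Matrix (Fin n) (Fin n) ℝ :=
    fun k t => NormedSpace.exp ((t - s k) • (-(Gk k).laplacian))
  let P : ℕ → Matrix (Fin n) (Fin n) ℝ := fun k => Nat.rec 1 (fun k Q => E k (s (k + 1)) * Q) k
  let F : ℕ → ℝ → Matrix (Fin n) (Fin n) ℝ := fun k t => E k t * P k
  have hE0 : ∀ k, E k (s k) = 1 := fun k => by simp [E]
  have hglue : ∀ k, F k (s (k + 1)) = F (k + 1) (s (k + 1)) := fun k => by
    simp only [F, hE0, one_mul]; rfl
  have hFd : ∀ k t, HasDerivAt (F k) (-(Gk k).laplacian * F k t) t := fun k t => by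
    have h1 := (hasDerivAt_exp_smul_const' (𝕂 := ℝ) (-(Gk k).laplacian) (t - s k)).scomp t
      ((hasDerivAt_id t).sub_const (s k))
    have h2 := h1.mul_const (P k)
    have h3 : HasDerivAt (F k) _ t := h2
    refine h3.congr_deriv ?_
    rw [one_smul]
    exact mul_assoc _ _ _
  have hcov : ∀ t, s 0 ≤ t → ∃ k, t ∈ Set.Ico (s k) (s (k + 1)) :=
    fun t ht => exists_mem_Ico_of_dwell hτ hs ht
  have huniq : ∀ {t j k}, t ∈ Set.Ico (s j) (s (j + 1)) → t ∈ Set.Ico (s k) (s (k + 1)) →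
      j = k := by
    intro t j k hj hk
    have h1 := hmono.lt_iff_lt.1 (hj.1.trans_lt hk.2)
    have h2 := hmono.lt_iff_lt.1 (hk.1.trans_lt hj.2)
    omega
  classical
  let Φ : ℝ → Matrix (Fin n) (Fin n) ℝ :=
    fun t => if ht : s 0 ≤ t then F (hcov t ht).choose t else 1
  have hΦ : ∀ k, ∀ t ∈ Set.Ico (s k) (s (k + 1)), Φ t = F k t := by
    intro k t ht
    have hge : s 0 ≤ t := (hmono.monotone (Nat.zero_le k)).trans ht.1
    simp only [Φ, dif_pos hge]
    rw [huniq (hcov t hge).choose_spec ht]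
  have hΦc : ∀ k, ∀ t ∈ Set.Icc (s k) (s (k + 1)), Φ t = F k t := by
    intro k t ht
    rcases ht.2.lt_or_eq with hlt | heq
    · exact hΦ k t ⟨ht.1, hlt⟩
    · rw [heq, hglue, hΦ (k + 1) _ ⟨le_rfl, hstep (k + 1)⟩]
  have hright : ∀ t ≥ t₀, HasDerivWithinAt Φ (-(G t).laplacian * Φ t) (Set.Ici t) t := by
    intro t ht
    obtain ⟨k, hk⟩ := hcov t (h0.le.trans ht)
    rw [hG k t hk, hΦ k t hk]
    refine (hFd k t).hasDerivWithinAt.congr_of_eventuallyEq ?_ (hΦ k t hk)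
    filter_upwards [Ico_mem_nhdsGE hk.2] with u hu
    exact hΦ k u ⟨hk.1.trans hu.1, hu.2⟩
  refine ⟨Φ, ?_, ?_, hright⟩
  · intro t ht
    rcases (show t₀ ≤ t from ht).eq_or_lt with rfl | hlt
    · exact (hright _ le_rfl).continuousWithinAt
    · refine (continuousAt_iff_continuous_left_right.2
        ⟨?_, (hright t ht).continuousWithinAt⟩).continuousWithinAt
      have hk : ∃ k, t ∈ Set.Ioc (s k) (s (k + 1)) := by
        obtain ⟨k, hk⟩ := hcov t (h0.le.trans ht)
        rcases hk.1.lt_or_eq with h1 | h1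
        · exact ⟨k, h1, hk.2.le⟩
        · cases k with
          | zero => exact absurd (h0.symm.trans h1) hlt.ne
          | succ k => exact ⟨k, h1 ▸ hstep k, h1.ge⟩
      obtain ⟨k, hk⟩ := hk
      refine (hFd k t).continuousAt.continuousWithinAt.congr_of_eventuallyEq ?_
        (hΦc k t ⟨hk.1.le, hk.2⟩)
      filter_upwards [Ioc_mem_nhdsLE hk.1] with u hu
      exact hΦc k u ⟨hu.1.le, hu.2.trans hk.2⟩
  · rw [← h0, hΦ 0 _ ⟨le_rfl, hstep 0⟩]
    simp [F, hE0, P]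

/-- Uniqueness of the state transition matrix of `x' = -L(t) x`. -/
theorem IsStateTransition.eqOn {n M : ℕ} {Gσ : Fin M → SignedDigraph n} {t₀ : ℝ}
    {G : ℝ → SignedDigraph n} (h : IsSwitching Gσ t₀ G) {Φ Ψ : ℝ → Matrix (Fin n) (Fin n) ℝ}
    (hΦ : IsStateTransition (fun t => -(G t).laplacian) t₀ Φ)
    (hΨ : IsStateTransition (fun t => -(G t).laplacian) t₀ Ψ) :
    Set.EqOn Φ Ψ (Set.Ici t₀) := by
  obtain ⟨s, τ, Gk, h0, hτ, hs, hr, hG⟩ := h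
  intro T hT
  have hLip : ∀ t ∈ Set.Ico t₀ T, LipschitzOnWith (∑ p, ‖-(Gσ p).laplacian‖₊)
      (fun X => -(G t).laplacian * X) Set.univ := by
    intro t ht
    obtain ⟨k, hk⟩ := exists_mem_Ico_of_dwell hτ hs (h0.le.trans ht.1)
    obtain ⟨p, hp⟩ := hr k
    rw [hG k t hk, ← hp]
    refine LipschitzWith.lipschitzOnWith (LipschitzWith.of_dist_le_mul fun X Y => ?_)
    rw [dist_eq_norm, dist_eq_norm, ← mul_sub]
    refine (norm_mul_le _ _).trans (mul_le_mul_of_nonneg_right ?_ (norm_nonneg _))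
    have := Finset.single_le_sum (f := fun p => ‖-(Gσ p).laplacian‖₊)
      (fun _ _ => zero_le) (Finset.mem_univ p)
    exact_mod_cast this
  exact ODE_solution_unique_of_mem_Icc_right (v := fun t X => -(G t).laplacian * X)
    (s := fun _ => Set.univ) hLip
    (hΦ.continuousOn.mono Set.Icc_subset_Ici_self) (fun t ht => hΦ.deriv_right t ht.1)
    (fun _ _ => trivial)
    (hΨ.continuousOn.mono Set.Icc_subset_Ici_self) (fun t ht => hΨ.deriv_right t ht.1)
    (fun _ _ => trivial) (hΦ.initial.trans hΨ.initial.symm) ⟨hT, le_rfl⟩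

end SignedNet

/-! ### Solutions and the decrease of their sup norm. -/

namespace SignedNet

/-! The sup norm of a solution never increases, so fix `m = ‖x t‖` and follow the gaps `m - ε x_i ≥
0` over all nodes `i` and signs `ε`. A gap decays at rate at most `D`, a bound on the degrees, and
while the edge from `j` to `i` is present a gap at `(j, ε)` feeds the gap at `(i, ε sgn a_ij)`.
Recurrence and the dwell time make both effects uniform in time, so gaps travel along paths of the
signed double cover of the union (`propagates_of_reflTransGen`).

Strong connectivity and unbalance make this cover strongly connected (`reflTransGen_coverStep`):
otherwise each node would be reached on one sheet only, and the choice of sheets would balance every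
mode.

At each node one of the two gaps is at least `m`. After a fixed time all gaps are therefore at least
`δ m`, which means that the norm has dropped by the factor `1 - δ` (`exists_contraction`). Iteration
gives exponential decay. -/

theorem SignedDigraph.laplacian_mulVec {n : ℕ} (G : SignedDigraph n) (x : Fin n → ℝ) (i : Fin n) :
    (G.laplacian.mulVec x) i = (∑ k, |G.adj i k|) * x i - ∑ k, G.adj i k * x k := by
  classical
  have hd : ∑ k ∈ G.neighbors i, |G.adj i k| = ∑ k, |G.adj i k| := by
    apply Finset.sum_subset (Finset.subset_univ _)
    intro k _ hk
    by_contra h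
    exact hk (Finset.mem_filter.2 ⟨Finset.mem_univ _, fun h0 => h (abs_eq_zero.2 h0)⟩)
  have h : ∀ k, G.laplacian i k * x k
      = (if k = i then (∑ k, |G.adj i k|) * x i else 0) - G.adj i k * x k := by
    intro k
    by_cases hk : k = i
    · subst hk
      simp [SignedDigraph.laplacian, hd, G.adj_self]
    · simp [SignedDigraph.laplacian, hk]
  simp only [Matrix.mulVec, dotProduct, h, Finset.sum_sub_distrib]
  simp

/-- A solution on `[t₀, ∞)` of `x' = -L(t) x`, with derivatives from the right. -/
structure IsSolution {n : ℕ} (G : ℝ → SignedDigraph n) (t₀ : ℝ) (x : ℝ → Fin n → ℝ) : Prop where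
  continuousOn : ContinuousOn x (Set.Ici t₀)
  deriv_right : ∀ t ≥ t₀, HasDerivWithinAt x (-((G t).laplacian.mulVec (x t))) (Set.Ici t) t

theorem IsStateTransition.isSolution_mulVec {n : ℕ} {G : ℝ → SignedDigraph n} {t₀ : ℝ}
    {Φ : ℝ → Matrix (Fin n) (Fin n) ℝ}
    (hΦ : IsStateTransition (fun t => -(G t).laplacian) t₀ Φ) (v : Fin n → ℝ) :
    IsSolution G t₀ (fun t => (Φ t).mulVec v) := by
  let e : Matrix (Fin n) (Fin n) ℝ →L[ℝ] (Fin n → ℝ) :=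
    LinearMap.toContinuousLinearMap
      ({ toFun := fun A => A.mulVec v
         map_add' := fun A B => Matrix.add_mulVec A B v
         map_smul' := fun c A => Matrix.smul_mulVec c A v } :
        Matrix (Fin n) (Fin n) ℝ →ₗ[ℝ] (Fin n → ℝ))
  refine ⟨e.continuous.comp_continuousOn hΦ.continuousOn, fun t ht => ?_⟩
  have h := e.hasFDerivAt.comp_hasDerivWithinAt t (hΦ.deriv_right t ht)
  refine h.congr_deriv ?_
  change (-(G t).laplacian * Φ t).mulVec v = _
  rw [← Matrix.mulVec_mulVec, Matrix.neg_mulVec]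

/-- An explicit Euler step of small positive size does not increase the sup norm. -/
theorem SignedDigraph.norm_sub_smul_laplacian_mulVec_le {n : ℕ} (G : SignedDigraph n)
    {D h : ℝ} (hD : ∀ i, ∑ k, |G.adj i k| ≤ D) (h0 : 0 ≤ h) (h1 : h * D ≤ 1) (x : Fin n → ℝ) :
    ‖x + h • -(G.laplacian.mulVec x)‖ ≤ ‖x‖ := by
  rw [pi_norm_le_iff_of_nonneg (norm_nonneg x)]
  intro i
  have hd : h * ∑ k, |G.adj i k| ≤ 1 := (mul_le_mul_of_nonneg_left (hD i) h0).trans h1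
  have e : (x + h • -(G.laplacian.mulVec x)) i
      = (1 - h * ∑ k, |G.adj i k|) * x i + h * ∑ k, G.adj i k * x k := by
    simp only [Pi.add_apply, Pi.smul_apply, Pi.neg_apply, smul_eq_mul, G.laplacian_mulVec]
    ring
  have hs : |∑ k, G.adj i k * x k| ≤ (∑ k, |G.adj i k|) * ‖x‖ := by
    rw [Finset.sum_mul]
    refine (Finset.abs_sum_le_sum_abs _ _).trans (Finset.sum_le_sum fun k _ => ?_)
    rw [abs_mul]
    exact mul_le_mul_of_nonneg_left (norm_le_pi_norm x k) (abs_nonneg _)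
  have hx : |x i| ≤ ‖x‖ := norm_le_pi_norm x i
  rw [e, Real.norm_eq_abs]
  refine (abs_add_le _ _).trans ?_
  rw [abs_mul, abs_mul, abs_of_nonneg (sub_nonneg.2 hd), abs_of_nonneg h0]
  nlinarith [mul_le_mul_of_nonneg_left hx (sub_nonneg.2 hd), mul_le_mul_of_nonneg_left hs h0]

/-- A solution agrees with its Euler step up to `o(z - r)`, and a short Euler step does not increase
the norm. The upper right derivative of the norm is thus at most zero, and Grönwall's inequality
applies with zero rate and zero forcing. -/
theorem IsSolution.norm_le_norm {n : ℕ} {G : ℝ → SignedDigraph n} {t₀ D : ℝ}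
    (hD : ∀ t ≥ t₀, ∀ i, ∑ k, |(G t).adj i k| ≤ D) {x : ℝ → Fin n → ℝ}
    (hx : IsSolution G t₀ x) {t s : ℝ} (ht : t₀ ≤ t) (hts : t ≤ s) : ‖x s‖ ≤ ‖x t‖ := by
  have key := le_gronwallBound_of_liminf_deriv_right_le (f := fun r => ‖x r‖)
    (f' := fun _ => 0) (δ := ‖x t‖) (K := 0) (ε := 0) (a := t) (b := s)
    (hx.continuousOn.mono fun r hr => ht.trans hr.1).norm ?_ le_rfl (fun _ _ => by simp) s
    ⟨hts, le_rfl⟩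
  · simpa [gronwallBound_K0] using key
  intro r hr ρ hρ
  have hr0 : t₀ ≤ r := ht.trans hr.1
  apply Filter.Eventually.frequently
  have hder := (hasDerivWithinAt_iff_isLittleO.1 (hx.deriv_right r hr0)).def (half_pos hρ)
  have hder' := hder.filter_mono (nhdsWithin_mono r Set.Ioi_subset_Ici_self)
  have hsmall : ∀ᶠ z in nhdsWithin r (Set.Ioi r), (z - r) * D < 1 := by
    have : Filter.Tendsto (fun z : ℝ => (z - r) * D) (nhds r) (nhds ((r - r) * D)) :=
      ((continuous_id.sub continuous_const).mul continuous_const).tendsto r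
    rw [sub_self, zero_mul] at this
    exact (this.eventually (gt_mem_nhds one_pos)).filter_mono nhdsWithin_le_nhds
  filter_upwards [hder', hsmall, self_mem_nhdsWithin] with z hz hzD hzr
  have hzr' : 0 < z - r := sub_pos.2 hzr
  have h1 := (G r).norm_sub_smul_laplacian_mulVec_le (hD r hr0) hzr'.le hzD.le (x r)
  have h2 : ‖x z‖ ≤ ‖x r‖ + ρ / 2 * (z - r) := by
    have : x z = (x z - x r - (z - r) • -((G r).laplacian.mulVec (x r)))
        + (x r + (z - r) • -((G r).laplacian.mulVec (x r))) := by abel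
    rw [this]
    refine (norm_add_le _ _).trans ?_
    rw [Real.norm_of_nonneg hzr'.le] at hz
    linarith
  rw [inv_mul_lt_iff₀ hzr']
  nlinarith

/-! ### Differential inequalities for the gaps `m - ε x_i`. -/

/-- A differential inequality `v' ≥ -D v + c` for right derivatives, integrated. -/
theorem le_of_deriv_right_ge {v v' : ℝ → ℝ} {a b c D : ℝ} (hab : a ≤ b) (hD : 0 < D)
    (hv : ContinuousOn v (Set.Icc a b))
    (hv' : ∀ t ∈ Set.Ico a b, HasDerivWithinAt v (v' t) (Set.Ici t) t)
    (hle : ∀ t ∈ Set.Ico a b, -D * v t + c ≤ v' t) :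
    Real.exp (-D * (b - a)) * v a + c / D * (1 - Real.exp (-D * (b - a))) ≤ v b := by
  have he : ∀ t, HasDerivAt (fun t => Real.exp (D * (t - a))) (Real.exp (D * (t - a)) * D) t := by
    intro t
    have := (((hasDerivAt_id t).sub_const a).const_mul D).exp
    simpa using this
  -- With the integrating factor, `(v - c / D) exp (D (t - a))` is nondecreasing; the comparison
  -- theorem is applied to its negative and a constant.
  have key := image_le_of_deriv_right_le_deriv_boundary
    (f := fun t => -((v t - c / D) * Real.exp (D * (t - a))))
    (f' := fun t => -(v' t * Real.exp (D * (t - a))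
      + (v t - c / D) * (Real.exp (D * (t - a)) * D)))
    (a := a) (b := b)
    (by
      refine ((hv.sub continuousOn_const).mul ?_).neg
      exact (Continuous.continuousOn (by fun_prop)))
    (fun t ht => (((hv' t ht).sub_const (c / D)).mul (he t).hasDerivWithinAt).neg)
    (B := fun _ => -(v a - c / D)) (B' := fun _ => 0) (by simp) continuousOn_const
    (fun t _ => hasDerivWithinAt_const _ _ _)
    (fun t ht => by
      have h := hle t ht
      have hc : c / D * D = c := div_mul_cancel₀ c hD.ne'
      have : 0 ≤ (v' t + D * v t - c) * Real.exp (D * (t - a)) :=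
        mul_nonneg (by linarith) (Real.exp_pos _).le
      have e : v' t * Real.exp (D * (t - a)) + (v t - c / D) * (Real.exp (D * (t - a)) * D)
          = (v' t + D * v t - c / D * D) * Real.exp (D * (t - a)) := by ring
      rw [e, hc]
      linarith)
    (x := b) ⟨hab, le_rfl⟩
  have hm : Real.exp (-D * (b - a)) * Real.exp (D * (b - a)) = 1 := by
    rw [← Real.exp_add]; simp
  have hp := mul_le_mul_of_nonneg_left (neg_le_neg key) (Real.exp_pos (-D * (b - a))).le
  have e : Real.exp (-D * (b - a)) * - -((v b - c / D) * Real.exp (D * (b - a)))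
      = v b - c / D := by
    rw [neg_neg, mul_left_comm, hm, mul_one]
  rw [e] at hp
  linarith

theorem abs_units_cast (ε : ℤˣ) : |((ε : ℤ) : ℝ)| = 1 := by
  rcases Int.units_eq_one_or ε with rfl | rfl <;> simp

theorem units_cast_mul_self (ε : ℤˣ) : ((ε : ℤ) : ℝ) * ((ε : ℤ) : ℝ) = 1 := by
  rcases Int.units_eq_one_or ε with rfl | rfl <;> simp

theorem units_cast_mul_le (ε : ℤˣ) (y : ℝ) : ((ε : ℤ) : ℝ) * y ≤ |y| := by
  refine (le_abs_self _).trans ?_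
  rw [abs_mul, abs_units_cast, one_mul]

theorem IsSolution.hasDerivWithinAt_gap {n : ℕ} {G : ℝ → SignedDigraph n} {t₀ : ℝ}
    {x : ℝ → Fin n → ℝ} (hx : IsSolution G t₀ x) (m : ℝ) (ε : ℤˣ) (i : Fin n) {t : ℝ}
    (ht : t₀ ≤ t) :
    HasDerivWithinAt (fun s => m - (ε : ℤ) * x s i)
      ((∑ k, |(G t).adj i k|) * ((ε : ℤ) * x t i)
        - ∑ k, (ε : ℤ) * ((G t).adj i k * x t k)) (Set.Ici t) t := by
  have h := ((hasDerivWithinAt_pi.1 (hx.deriv_right t ht) i).const_mul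
    (((ε : ℤ) : ℝ))).const_sub m
  refine h.congr_deriv ?_
  rw [Pi.neg_apply, SignedDigraph.laplacian_mulVec, ← Finset.mul_sum]
  ring

theorem IsSolution.continuousOn_gap {n : ℕ} {G : ℝ → SignedDigraph n} {t₀ : ℝ}
    {x : ℝ → Fin n → ℝ} (hx : IsSolution G t₀ x) (m : ℝ) (ε : ℤˣ) (i : Fin n) {a b : ℝ}
    (ha : t₀ ≤ a) : ContinuousOn (fun s => m - (ε : ℤ) * x s i) (Set.Icc a b) :=
  continuousOn_const.sub (continuousOn_const.mul
    ((continuousOn_pi.1 hx.continuousOn i).mono fun _ hr => ha.trans hr.1))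

theorem gap_nonneg {n : ℕ} {y : Fin n → ℝ} {m : ℝ} (h : ‖y‖ ≤ m) (ε : ℤˣ) (i : Fin n) :
    0 ≤ m - (ε : ℤ) * y i :=
  sub_nonneg.2 ((units_cast_mul_le ε _).trans ((norm_le_pi_norm y i).trans h))

/-- The neighbours push `ε x_i` up by at most `(∑ k, |a_ik|) m`, so the derivative of the gap is at
least minus the degree times the gap. -/
theorem IsSolution.gap_persists {n : ℕ} {G : ℝ → SignedDigraph n} {t₀ D m : ℝ} (hD0 : 0 < D)
    (hD : ∀ t ≥ t₀, ∀ i, ∑ k, |(G t).adj i k| ≤ D) {x : ℝ → Fin n → ℝ}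
    (hx : IsSolution G t₀ x) {t s : ℝ} (ht : t₀ ≤ t) (hts : t ≤ s)
    (hm : ∀ r ≥ t, ‖x r‖ ≤ m) (ε : ℤˣ) (i : Fin n) :
    Real.exp (-D * (s - t)) * (m - (ε : ℤ) * x t i) ≤ m - (ε : ℤ) * x s i := by
  have h := le_of_deriv_right_ge (c := 0) hts hD0 (hx.continuousOn_gap m ε i ht)
    (fun r hr => hx.hasDerivWithinAt_gap m ε i (ht.trans hr.1)) ?_
  · simpa using h
  intro r hr
  have hg := gap_nonneg (hm r hr.1) ε i
  have hdD := mul_le_mul_of_nonneg_right (hD r (ht.trans hr.1) i) hg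
  have hs : ∑ k, (ε : ℤ) * ((G r).adj i k * x r k) ≤ (∑ k, |(G r).adj i k|) * m := by
    rw [Finset.sum_mul]
    refine Finset.sum_le_sum fun k _ => (units_cast_mul_le ε _).trans ?_
    rw [abs_mul]
    exact mul_le_mul_of_nonneg_left ((norm_le_pi_norm _ k).trans (hm r hr.1)) (abs_nonneg _)
  linarith

/-- On an interval on which the edge from `j` to `i` is present, a gap at `j` produces a gap at
`i`. -/
theorem IsSolution.gap_of_edge {n : ℕ} {G : ℝ → SignedDigraph n} {t₀ D m η : ℝ} (hD0 : 0 < D)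
    (hD : ∀ t ≥ t₀, ∀ i, ∑ k, |(G t).adj i k| ≤ D) {x : ℝ → Fin n → ℝ}
    (hx : IsSolution G t₀ x) {a b : ℝ} (ha : t₀ ≤ a) (hab : a ≤ b)
    (hm : ∀ r ≥ a, ‖x r‖ ≤ m) {i j : Fin n} {ε ε' : ℤˣ} {H : SignedDigraph n}
    (hG : ∀ r ∈ Set.Ico a b, G r = H)
    (hsign : 0 < ((ε' : ℤ) : ℝ) * H.adj i j * (ε : ℤ))
    (hη : ∀ r ∈ Set.Ico a b, η ≤ m - (ε : ℤ) * x r j) :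
    |H.adj i j| * η / D * (1 - Real.exp (-D * (b - a))) ≤ m - (ε' : ℤ) * x b i := by
  have h := le_of_deriv_right_ge (c := |H.adj i j| * η) hab hD0 (hx.continuousOn_gap m ε' i ha)
    (fun r hr => hx.hasDerivWithinAt_gap m ε' i (ha.trans hr.1)) ?_
  · have := mul_nonneg (Real.exp_pos (-D * (b - a))).le (gap_nonneg (hm a le_rfl) ε' i)
    linarith
  intro r hr
  have hg := gap_nonneg (hm r hr.1) ε' i
  have hdD := mul_le_mul_of_nonneg_right (hD r (ha.trans hr.1) i) hg
  rw [hG r hr] at hdD ⊢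
  -- The sign condition aligns the edge with the two signs, so the contribution of `j` falls short
  -- of `|a_ij| m` by `|a_ij|` times the gap at `j`.
  have hw : ((ε' : ℤ) : ℝ) * H.adj i j = |H.adj i j| * (ε : ℤ) := by
    have h1 : ((ε' : ℤ) : ℝ) * H.adj i j * (ε : ℤ) = |H.adj i j| := by
      rw [← abs_of_pos hsign, abs_mul, abs_mul, abs_units_cast, abs_units_cast, one_mul, mul_one]
    rw [← h1, mul_assoc, units_cast_mul_self, mul_one]
  have hterm : ∀ k, (ε' : ℤ) * (H.adj i k * x r k)
      ≤ |H.adj i k| * m - if k = j then |H.adj i j| * η else 0 := by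
    intro k
    split_ifs with hk
    · subst hk
      rw [← mul_assoc, hw, mul_assoc, ← mul_sub]
      exact mul_le_mul_of_nonneg_left (by linarith [hη r hr]) (abs_nonneg _)
    · rw [sub_zero]
      refine (units_cast_mul_le ε' _).trans ?_
      rw [abs_mul]
      exact mul_le_mul_of_nonneg_left ((norm_le_pi_norm _ k).trans (hm r hr.1)) (abs_nonneg _)
  have hs : ∑ k, (ε' : ℤ) * (H.adj i k * x r k)
      ≤ (∑ k, |H.adj i k|) * m - |H.adj i j| * η := by
    refine (Finset.sum_le_sum fun k _ => hterm k).trans ?_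
    rw [Finset.sum_sub_distrib, ← Finset.sum_mul]
    simp
  linarith

/-! ### Uniform constants from the dwell time and the finite set of modes. -/

/-- Recurrence yields only an instant `u` of each mode. Its dwell interval has length at least `τ`,
so it contains `τ / 2` of time just before or just after `u`. Searching from `t + τ` keeps the first
option after `t`. -/
theorem exists_active_interval {n M : ℕ} {Gσ : Fin M → SignedDigraph n} {t₀ : ℝ}
    {G : ℝ → SignedDigraph n} (hswitch : IsSwitching Gσ t₀ G) (hrec : Recurrent Gσ t₀ G) :
    ∃ W > 0, ∃ h > 0, ∀ p, ∀ t ≥ t₀, ∃ a ≥ t, a + h ≤ t + W ∧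
      ∀ r ∈ Set.Ico a (a + h), G r = Gσ p := by
  obtain ⟨s, τ, Gk, h0, hτ, hs, -, hG⟩ := hswitch
  obtain ⟨T, hT, hrec⟩ := hrec
  refine ⟨T + 2 * τ, by positivity, τ / 2, by positivity, fun p t ht => ?_⟩
  obtain ⟨u, hu, hu1, hu2⟩ := hrec p (t + τ) (by linarith)
  obtain ⟨k, hk⟩ := exists_mem_Ico_of_dwell hτ hs (t := u) (by linarith)
  have hkp : Gk k = Gσ p := (hG k u hk).symm.trans hu
  have hk1 := hk.1
  have hk2 := hk.2
  by_cases hc : s k ≤ u - τ / 2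
  · refine ⟨u - τ / 2, by linarith, by linarith, fun r hr => ?_⟩
    have hr1 := hr.1
    have hr2 := hr.2
    rw [← hkp]
    exact hG k r ⟨by linarith, by linarith⟩
  · have := hs k
    refine ⟨u, by linarith, by linarith, fun r hr => ?_⟩
    have hr1 := hr.1
    have hr2 := hr.2
    rw [← hkp]
    exact hG k r ⟨by linarith, by linarith⟩

theorem IsSwitching.mem_range {n M : ℕ} {Gσ : Fin M → SignedDigraph n} {t₀ : ℝ}
    {G : ℝ → SignedDigraph n} (hswitch : IsSwitching Gσ t₀ G) {t : ℝ} (ht : t₀ ≤ t) :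
    G t ∈ Set.range Gσ := by
  obtain ⟨s, τ, Gk, h0, hτ, hs, hr, hG⟩ := hswitch
  obtain ⟨k, hk⟩ := exists_mem_Ico_of_dwell hτ hs (h0.le.trans ht)
  rw [hG k t hk]
  exact hr k

theorem IsSwitching.exists_degree_bound {n M : ℕ} {Gσ : Fin M → SignedDigraph n} {t₀ : ℝ}
    {G : ℝ → SignedDigraph n} (hswitch : IsSwitching Gσ t₀ G) :
    ∃ D > 0, ∀ t ≥ t₀, ∀ i, ∑ k, |(G t).adj i k| ≤ D := by
  have hnn : ∀ p i, 0 ≤ ∑ k, |(Gσ p).adj i k| :=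
    fun p i => Finset.sum_nonneg fun _ _ => abs_nonneg _
  -- The summand `1` keeps the bound positive, since the gap estimates divide by it.
  refine ⟨(∑ p, ∑ i, ∑ k, |(Gσ p).adj i k|) + 1, ?_, fun t ht i => ?_⟩
  · have := Finset.sum_nonneg fun p (_ : p ∈ Finset.univ) =>
      Finset.sum_nonneg fun i (_ : i ∈ Finset.univ) => hnn p i
    linarith
  · obtain ⟨p, hp⟩ := hswitch.mem_range ht
    rw [← hp]
    have h1 := Finset.single_le_sum (fun i _ => hnn p i) (Finset.mem_univ i)
    have h2 := Finset.single_le_sum (f := fun p => ∑ i, ∑ k, |(Gσ p).adj i k|)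
      (fun p _ => Finset.sum_nonneg fun i (_ : i ∈ Finset.univ) => hnn p i) (Finset.mem_univ p)
    linarith

/-! ### Propagation of gaps along the signed double cover. -/

/-- An edge of the signed double cover of the union of a family of signed digraphs. -/
def CoverStep {n M : ℕ} (Gσ : Fin M → SignedDigraph n) (q q' : Fin n × ℤˣ) : Prop :=
  ∃ p, 0 < ((q'.2 : ℤ) : ℝ) * (Gσ p).adj q'.1 q.1 * (q.2 : ℤ)

/-- Whenever a solution with sup norm at most `m` has a gap to `m` at `q`, a fixed time later it
has a gap, smaller by at most a fixed factor, at `q'`. -/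
def Propagates {n : ℕ} (G : ℝ → SignedDigraph n) (t₀ : ℝ) (q q' : Fin n × ℤˣ) : Prop :=
  ∃ W ≥ 0, ∃ c > 0, ∀ x, IsSolution G t₀ x → ∀ t ≥ t₀, ∀ m, (∀ r ≥ t, ‖x r‖ ≤ m) →
    c * (m - (q.2 : ℤ) * x t q.1) ≤ m - (q'.2 : ℤ) * x (t + W) q'.1

/-- The gap at `q` survives until the edge's active interval ends, at a cost of at most `exp (-D
W)`. It is transferred during that interval, and the new gap survives until `t + W` at the same
cost. -/
theorem propagates_of_coverStep {n M : ℕ} {Gσ : Fin M → SignedDigraph n} {t₀ : ℝ}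
    {G : ℝ → SignedDigraph n} (hswitch : IsSwitching Gσ t₀ G) (hrec : Recurrent Gσ t₀ G)
    {q q' : Fin n × ℤˣ} (hq : CoverStep Gσ q q') : Propagates G t₀ q q' := by
  obtain ⟨D, hD0, hD⟩ := hswitch.exists_degree_bound
  obtain ⟨W, hW, h, hh, hact⟩ := exists_active_interval hswitch hrec
  obtain ⟨p, hp⟩ := hq
  have hw : 0 < |(Gσ p).adj q'.1 q.1| := by
    refine abs_pos.2 fun h0 => hp.ne' ?_
    rw [h0, mul_zero, zero_mul]
  have hexp : 0 < 1 - Real.exp (-D * h) := by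
    rw [sub_pos, Real.exp_lt_one_iff]
    nlinarith
  refine ⟨W, hW.le, Real.exp (-D * W) *
    (|(Gσ p).adj q'.1 q.1| * Real.exp (-D * W) / D * (1 - Real.exp (-D * h))),
    by positivity, ?_⟩
  intro x hx t ht m hm
  obtain ⟨a, hat, haW, hG⟩ := hact p t ht
  have hg := gap_nonneg (hm t le_rfl) q.2 q.1
  have hmono : ∀ r ≤ W, Real.exp (-D * W) ≤ Real.exp (-D * r) := by
    intro r hr
    apply Real.exp_le_exp.2
    nlinarith
  have h1 := hx.gap_of_edge hD0 hD (m := m) (ht.le.trans hat) (by linarith : a ≤ a + h)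
    (fun r hr => hm r (hat.le.trans hr)) hG hp
    (η := Real.exp (-D * W) * (m - (q.2 : ℤ) * x t q.1)) (fun r hr => by
      have h2 := hx.gap_persists hD0 hD ht (hat.le.trans hr.1) hm q.2 q.1
      refine (mul_le_mul_of_nonneg_right (hmono (r - t) ?_) hg).trans h2
      linarith [hr.2])
  have h3 := hx.gap_persists hD0 hD (by linarith : t₀ ≤ a + h) haW
    (fun r hr => hm r (by linarith)) q'.2 q'.1
  have h4 := gap_nonneg (hm (a + h) (by linarith)) q'.2 q'.1
  have h5 := (mul_le_mul_of_nonneg_right (hmono (t + W - (a + h)) (by linarith)) h4).trans h3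
  have h6 := (mul_le_mul_of_nonneg_left h1 (Real.exp_pos (-D * W)).le).trans h5
  rw [add_sub_cancel_left] at h6
  refine le_of_eq_of_le ?_ h6
  ring

theorem propagates_of_reflTransGen {n M : ℕ} {Gσ : Fin M → SignedDigraph n} {t₀ : ℝ}
    {G : ℝ → SignedDigraph n} (hswitch : IsSwitching Gσ t₀ G) (hrec : Recurrent Gσ t₀ G)
    {q q' : Fin n × ℤˣ} (hq : Relation.ReflTransGen (CoverStep Gσ) q q') :
    Propagates G t₀ q q' := by
  induction hq with
  | refl => exact ⟨0, le_rfl, 1, one_pos, fun x _ t _ m _ => by simp⟩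
  | tail _ hstep ih =>
    obtain ⟨W, hW, c, hc, h⟩ := ih
    obtain ⟨W', hW', c', hc', h'⟩ := propagates_of_coverStep hswitch hrec hstep
    refine ⟨W + W', by linarith, c' * c, by positivity, fun x hx t ht m hm => ?_⟩
    have h1 := h x hx t ht m hm
    have h2 := h' x hx (t + W) (by linarith) m (fun r hr => hm r (by linarith))
    rw [← add_assoc, mul_assoc]
    exact (mul_le_mul_of_nonneg_left h1 hc'.le).trans h2

/-- Exchanging the two sheets is an automorphism of the cover. -/
theorem CoverStep.neg {n M : ℕ} {Gσ : Fin M → SignedDigraph n} {q q' : Fin n × ℤˣ}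
    (h : CoverStep Gσ q q') : CoverStep Gσ (q.1, -q.2) (q'.1, -q'.2) := by
  obtain ⟨p, hp⟩ := h
  exact ⟨p, by simpa using hp⟩

theorem reflTransGen_coverStep_neg {n M : ℕ} {Gσ : Fin M → SignedDigraph n} {q q' : Fin n × ℤˣ}
    (h : Relation.ReflTransGen (CoverStep Gσ) q q') :
    Relation.ReflTransGen (CoverStep Gσ) (q.1, -q.2) (q'.1, -q'.2) :=
  h.lift (fun q => (q.1, -q.2)) fun _ _ => CoverStep.neg

/-- Every edge of the union lifts from either sheet; a negative weight changes the sheet. -/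
theorem exists_coverStep_of_ne_zero {n M : ℕ} {Gσ : Fin M → SignedDigraph n} {p : Fin M}
    {i j : Fin n} (h : (Gσ p).adj i j ≠ 0) (ε : ℤˣ) : ∃ ε', CoverStep Gσ (j, ε) (i, ε') := by
  rcases h.lt_or_gt with h | h
  · refine ⟨-ε, p, ?_⟩
    have := units_cast_mul_self ε
    push_cast
    nlinarith
  · refine ⟨ε, p, ?_⟩
    have := units_cast_mul_self ε
    nlinarith

theorem exists_reflTransGen_coverStep_of_hasPath {n M : ℕ} {Gσ : Fin M → SignedDigraph n}
    {i j : Fin n} (h : HasPath (unionEdges Gσ) i j) (ε : ℤˣ) :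
    ∃ ε', Relation.ReflTransGen (CoverStep Gσ) (i, ε) (j, ε') := by
  obtain ⟨l, v, -, rfl, rfl, hE⟩ := h
  suffices ∀ k : Fin (l + 1), ∃ ε', Relation.ReflTransGen (CoverStep Gσ) (v 0, ε) (v k, ε') from
    this _
  intro k
  induction k using Fin.induction with
  | zero => exact ⟨ε, .refl⟩
  | succ k ih =>
    obtain ⟨ε', h⟩ := ih
    obtain ⟨p, hp⟩ := Set.mem_iUnion.1 (hE k)
    obtain ⟨ε'', h'⟩ := exists_coverStep_of_ne_zero (Gσ := Gσ) hp ε'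
    exact ⟨ε'', h.tail h'⟩

/-- The signed double cover of a strongly connected unbalanced family is strongly connected. -/
theorem reflTransGen_coverStep {n M : ℕ} {Gσ : Fin M → SignedDigraph n}
    (hconn : StronglyConnected (unionEdges Gσ))
    (hunb : ¬ ∃ d : Fin n → ℤˣ, ∀ p i j, ((d i : ℤ) : ℝ) * (Gσ p).adj i j * (d j : ℤ)
      = |(Gσ p).adj i j|) (q q' : Fin n × ℤˣ) :
    Relation.ReflTransGen (CoverStep Gσ) q q' := by
  have hlift : ∀ (i j : Fin n) (ε : ℤˣ),
      ∃ ε', Relation.ReflTransGen (CoverStep Gσ) (i, ε) (j, ε') := by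
    intro i j ε
    by_cases hij : i = j
    · exact ⟨ε, hij ▸ .refl⟩
    · exact exists_reflTransGen_coverStep_of_hasPath (hconn i j hij) ε
  have hcases : ∀ ε ε' : ℤˣ, ε' = ε ∨ ε' = -ε := by
    intro ε ε'
    rcases Int.units_eq_one_or ε with rfl | rfl <;>
      rcases Int.units_eq_one_or ε' with rfl | rfl <;> simp
  -- The question is whether a closed walk of negative sign passes through `q'.1`. If so, it
  -- corrects a lift that ends on the wrong sheet.
  by_cases hloop : Relation.ReflTransGen (CoverStep Gσ) (q'.1, 1) (q'.1, -1)
  · have hloop' : ∀ ε : ℤˣ, Relation.ReflTransGen (CoverStep Gσ) (q'.1, ε) (q'.1, -ε) := by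
      intro ε
      rcases Int.units_eq_one_or ε with rfl | rfl
      · exact hloop
      · exact reflTransGen_coverStep_neg hloop
    obtain ⟨ε, h⟩ := hlift q.1 q'.1 q.2
    rcases hcases ε q'.2 with he | he
    · rw [← he] at h
      exact h
    · have := hloop' ε
      rw [← he] at this
      exact h.trans this
  · exfalso
    -- Without such a walk, no node is reached on both sheets: going back to `q'.1` from both, one
    -- return being the sheet-swapped copy of the other, would give one.
    have huniq : ∀ j (ε ε' : ℤˣ), Relation.ReflTransGen (CoverStep Gσ) (q'.1, 1) (j, ε) →
        Relation.ReflTransGen (CoverStep Gσ) (q'.1, 1) (j, ε') → ε' = ε := by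
      intro j ε ε' h h'
      by_contra hne
      rw [(hcases ε ε').resolve_left hne] at h'
      obtain ⟨e, he⟩ := hlift j q'.1 ε
      rcases hcases 1 e with rfl | rfl
      · exact hloop (h'.trans (reflTransGen_coverStep_neg he))
      · exact hloop (h.trans he)
    choose d hd using fun j => hlift q'.1 j 1
    refine hunb ⟨d, fun p i j => ?_⟩
    by_cases ha : (Gσ p).adj i j = 0
    · simp [ha]
    · have hpos : 0 < ((d i : ℤ) : ℝ) * (Gσ p).adj i j * (d j : ℤ) := by
        by_contra hneg
        have hne : ((d i : ℤ) : ℝ) * (Gσ p).adj i j * (d j : ℤ) ≠ 0 := by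
          refine mul_ne_zero (mul_ne_zero ?_ ha) ?_ <;> exact_mod_cast Units.ne_zero _
        -- An edge violating the signing `d` would reach `i` on its second sheet.
        have hstep : CoverStep Gσ (j, d j) (i, -d i) := by
          refine ⟨p, ?_⟩
          have := lt_of_le_of_ne (not_lt.1 hneg) hne
          push_cast
          linarith
        have := huniq i _ _ (hd i) ((hd j).tail hstep)
        exact absurd this (by simp)
      rw [← abs_of_pos hpos, abs_mul, abs_mul, abs_units_cast, abs_units_cast, one_mul, mul_one]

/-- Every `G t` is one of the modes, so a signing that balances all modes balances `G`. -/
theorem not_exists_signing_of_simultaneouslyUnbalanced {n M : ℕ} {Gσ : Fin M → SignedDigraph n}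
    {t₀ : ℝ} {G : ℝ → SignedDigraph n} (hswitch : IsSwitching Gσ t₀ G)
    (hunb : SimultaneouslyUnbalanced t₀ G) :
    ¬ ∃ d : Fin n → ℤˣ, ∀ p i j, ((d i : ℤ) : ℝ) * (Gσ p).adj i j * (d j : ℤ)
      = |(Gσ p).adj i j| := by
  rintro ⟨d, hd⟩
  refine hunb ⟨fun i => ((d i : ℤ) : ℝ), fun i => ?_, fun t ht => ?_⟩
  · rcases Int.units_eq_one_or (d i) with h | h <;> simp [h]
  · obtain ⟨p, hp⟩ := hswitch.mem_range ht
    ext i j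
    rw [← hp, Matrix.mul_diagonal, Matrix.diagonal_mul, Matrix.map_apply]
    exact hd p i j

/-! ### Contraction and exponential decay. -/

/-- Over a fixed time, the sup norm of every solution contracts by a fixed factor. -/
theorem exists_contraction {n M : ℕ} {Gσ : Fin M → SignedDigraph n} {t₀ : ℝ}
    {G : ℝ → SignedDigraph n} (hswitch : IsSwitching Gσ t₀ G) (hrec : Recurrent Gσ t₀ G)
    (hconn : StronglyConnected (unionEdges Gσ)) (hunb : SimultaneouslyUnbalanced t₀ G) :
    ∃ W > 0, ∃ κ, 0 < κ ∧ κ < 1 ∧ ∀ x, IsSolution G t₀ x → ∀ t ≥ t₀,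
      ‖x (t + W)‖ ≤ κ * ‖x t‖ := by
  obtain ⟨D, hD0, hD⟩ := hswitch.exists_degree_bound
  have hprop : ∀ qq : (Fin n × ℤˣ) × (Fin n × ℤˣ), Propagates G t₀ qq.1 qq.2 := fun qq =>
    propagates_of_reflTransGen hswitch hrec (reflTransGen_coverStep hconn
      (not_exists_signing_of_simultaneouslyUnbalanced hswitch hunb) _ _)
  choose W hW c hc hWc using hprop
  -- There are finitely many pairs of cover vertices, so one time and one factor serve all.
  -- Persistence carries each gap from its own arrival time to the common time.
  obtain ⟨Wm, hWm⟩ := (Set.finite_range W).bddAbove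
  have hWle : ∀ qq, W qq ≤ max Wm 1 := fun qq => (hWm ⟨qq, rfl⟩).trans (le_max_left _ _)
  obtain ⟨c₀, hc0, hcle⟩ : ∃ c₀ > 0, ∀ qq, c₀ ≤ c qq := by
    rcases isEmpty_or_nonempty ((Fin n × ℤˣ) × (Fin n × ℤˣ)) with hE | hE
    · exact ⟨1, one_pos, fun qq => hE.elim qq⟩
    · obtain ⟨q₀, hq₀⟩ := Finite.exists_min c
      exact ⟨c q₀, hc q₀, hq₀⟩
  set V := max Wm 1
  have hV : 0 < V := lt_of_lt_of_le one_pos (le_max_right _ _)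
  have hδ : 0 < Real.exp (-D * V) * c₀ := mul_pos (Real.exp_pos _) hc0
  -- The lower bound `1 / 2` makes the factor positive, as its logarithm and inverse are used later.
  refine ⟨V, hV, max (1 - Real.exp (-D * V) * c₀) (1 / 2), lt_max_of_lt_right (by norm_num),
    max_lt (by linarith) (by norm_num), fun x hx t ht => ?_⟩
  have hm : ∀ r ≥ t, ‖x r‖ ≤ ‖x t‖ := fun r hr => hx.norm_le_norm hD ht hr
  refine le_trans ?_ (mul_le_mul_of_nonneg_right (le_max_left _ _) (norm_nonneg _))
  have hgap : ∀ (i : Fin n) (ε : ℤˣ),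
      Real.exp (-D * V) * c₀ * ‖x t‖ ≤ ‖x t‖ - (ε : ℤ) * x (t + V) i := by
    intro i ε
    -- For this sign the initial gap at `i` is at least the full norm `‖x t‖`.
    obtain ⟨ε₀, hε₀⟩ : ∃ ε₀ : ℤˣ, ((ε₀ : ℤ) : ℝ) * x t i ≤ 0 := by
      rcases le_total (x t i) 0 with h | h
      · exact ⟨1, by simpa using h⟩
      · exact ⟨-1, by simpa using h⟩
    have h1 := hWc ((i, ε₀), (i, ε)) x hx t ht _ hm
    simp only at h1
    have h2 : c₀ * ‖x t‖ ≤ ‖x t‖ - (ε : ℤ) * x (t + W ((i, ε₀), (i, ε))) i := by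
      refine le_trans ?_ h1
      exact mul_le_mul (hcle _) (by linarith) (norm_nonneg _) (hc _).le
    set w := W ((i, ε₀), (i, ε))
    have hw0 : 0 ≤ w := hW _
    have hwV : w ≤ V := hWle _
    have h3 := hx.gap_persists hD0 hD (by linarith : t₀ ≤ t + w) (by linarith : t + w ≤ t + V)
      (fun r hr => hm r (by linarith)) ε i
    refine le_trans ?_ h3
    rw [mul_assoc]
    refine mul_le_mul (Real.exp_le_exp.2 (by nlinarith)) h2 (by positivity) (Real.exp_pos _).le
  -- Adding the gaps of both signs at one node shows the bound to be nonnegative, as the sup norm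
  -- criterion requires; with no nodes there is no such node.
  have hκ0 : 0 ≤ (1 - Real.exp (-D * V) * c₀) * ‖x t‖ ∨ IsEmpty (Fin n) := by
    rcases isEmpty_or_nonempty (Fin n) with hE | ⟨⟨i⟩⟩
    · exact Or.inr hE
    · left
      have h1 := hgap i 1
      have h2 := hgap i (-1)
      push_cast at h1 h2
      linarith
  rcases hκ0 with hκ0 | hE
  · rw [pi_norm_le_iff_of_nonneg hκ0]
    intro i
    have h1 := hgap i 1
    have h2 := hgap i (-1)
    push_cast at h1 h2
    rw [Real.norm_eq_abs, abs_le]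
    constructor <;> linarith
  · simp [Subsingleton.elim (x t) 0, Subsingleton.elim (x (t + V)) 0]

/-- A uniform contraction over a fixed time, for a nonincreasing function, gives exponential
decay. -/
theorem exists_exp_decay_of_contraction {t₀ W κ : ℝ} (hW : 0 < W) (hκ0 : 0 < κ) (hκ1 : κ < 1) :
    ∃ C > 0, ∃ lam > 0, ∀ f : ℝ → ℝ, 0 ≤ f t₀ → (∀ t ≥ t₀, ∀ s ≥ t, f s ≤ f t) →
      (∀ t ≥ t₀, f (t + W) ≤ κ * f t) →
      ∀ t ≥ t₀, f t ≤ C * Real.exp (-lam * (t - t₀)) * f t₀ := by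
  have hlog : Real.log κ < 0 := Real.log_neg hκ0 hκ1
  -- The factor `κ⁻¹` pays for the incomplete last period: the number of full periods exceeds `(t -
  -- t₀) / W - 1`.
  refine ⟨κ⁻¹, inv_pos.2 hκ0, -Real.log κ / W, div_pos (neg_pos.2 hlog) hW, ?_⟩
  intro f h0 hmono hcontr t ht
  have hiter : ∀ k : ℕ, f (t₀ + k * W) ≤ κ ^ k * f t₀ := by
    intro k
    induction k with
    | zero => simp
    | succ k ih =>
      have h1 := hcontr (t₀ + k * W) (by nlinarith [Nat.cast_nonneg (α := ℝ) k])
      have e : t₀ + ((k + 1 : ℕ) : ℝ) * W = t₀ + k * W + W := by push_cast; ring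
      rw [e, pow_succ', mul_assoc]
      exact h1.trans (mul_le_mul_of_nonneg_left ih hκ0.le)
  have hy : 0 ≤ (t - t₀) / W := div_nonneg (by linarith) hW.le
  have hk1 := Nat.floor_le hy
  have hk2 := Nat.lt_floor_add_one ((t - t₀) / W)
  set k := ⌊(t - t₀) / W⌋₊
  rw [le_div_iff₀ hW] at hk1
  refine (hmono (t₀ + k * W) (by nlinarith [Nat.cast_nonneg (α := ℝ) k]) t (by linarith)).trans
    ((hiter k).trans (mul_le_mul_of_nonneg_right ?_ h0))
  have hpow : κ ^ k = Real.exp (k * Real.log κ) := by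
    rw [Real.exp_nat_mul, Real.exp_log hκ0]
  have hinv : κ⁻¹ = Real.exp (-Real.log κ) := by rw [Real.exp_neg, Real.exp_log hκ0]
  rw [hpow, hinv, ← Real.exp_add]
  apply Real.exp_le_exp.2
  have e : -Real.log κ + -(-Real.log κ / W) * (t - t₀)
      = ((t - t₀) / W - 1) * Real.log κ := by
    field_simp
    ring
  rw [e]
  exact mul_le_mul_of_nonpos_right (by linarith) hlog.le

theorem matrix_norm_le_of_mulVec_norm_le {n : ℕ} {A : Matrix (Fin n) (Fin n) ℝ} {b : ℝ}
    (hb : 0 ≤ b) (h : ∀ v : Fin n → ℝ, ‖A.mulVec v‖ ≤ b * ‖v‖) : ‖A‖ ≤ b := by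
  rw [Matrix.linfty_opNorm_eq_opNorm]
  exact ContinuousLinearMap.opNorm_le_bound _ hb h

end SignedNet

/-- If a switching signed digraph visits each of its finitely many modes in every window of some
fixed length, the union of the modes is strongly connected, and the switching signed digraph is
simultaneously structurally unbalanced, then its state transition matrix tends to zero
exponentially fast. -/
theorem theorem6 {n M : ℕ} (Gσ : Fin M → SignedNet.SignedDigraph n) (t₀ : ℝ) (ht₀ : 0 ≤ t₀)
    (G : ℝ → SignedNet.SignedDigraph n)
    (hswitch : SignedNet.IsSwitching Gσ t₀ G)
    (hrec : SignedNet.Recurrent Gσ t₀ G)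
    (hconn : SignedNet.StronglyConnected (SignedNet.unionEdges Gσ))
    (hunb : SignedNet.SimultaneouslyUnbalanced t₀ G)
    (Φ : ℝ → Matrix (Fin n) (Fin n) ℝ)
    (hΦ : SignedNet.IsStateTransition (fun t => -(G t).laplacian) t₀ Φ) :
    Filter.Tendsto Φ Filter.atTop (nhds 0) ∧
      ∃ C > 0, ∃ lam > 0, ∀ t ≥ t₀, ‖Φ t‖ ≤ C * Real.exp (-lam * (t - t₀)) := by
  obtain ⟨D, -, hD⟩ := hswitch.exists_degree_bound
  obtain ⟨W, hW, κ, hκ0, hκ1, hcontr⟩ :=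
    SignedNet.exists_contraction hswitch hrec hconn hunb
  obtain ⟨C, hC, lam, hlam, hdecay⟩ :=
    SignedNet.exists_exp_decay_of_contraction (t₀ := t₀) hW hκ0 hκ1
  have hbound : ∀ t ≥ t₀, ‖Φ t‖ ≤ C * Real.exp (-lam * (t - t₀)) := by
    intro t ht
    -- The constants do not depend on the solution, so the bound is uniform in the initial vector
    -- `v` and passes to the operator norm.
    refine SignedNet.matrix_norm_le_of_mulVec_norm_le (by positivity) fun v => ?_
    have hx := hΦ.isSolution_mulVec v
    have h := hdecay (fun s => ‖(Φ s).mulVec v‖) (norm_nonneg _)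
      (fun r hr s hs => hx.norm_le_norm hD hr hs) (fun r hr => hcontr _ hx r hr) t ht
    simpa [hΦ.initial] using h
  refine ⟨?_, C, hC, lam, hlam, hbound⟩
  refine squeeze_zero_norm' (Filter.eventually_atTop.2 ⟨t₀, hbound⟩) ?_
  have h1 : Filter.Tendsto (fun t : ℝ => -lam * (t - t₀)) Filter.atTop Filter.atBot :=
    (Filter.tendsto_atTop_add_const_right _ (-t₀) Filter.tendsto_id).const_mul_atTop_of_neg
      (neg_lt_zero.2 hlam)
  simpa using (Real.tendsto_exp_atBot.comp h1).const_mul C
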